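/- Let $m\ge 0$, let $X=\{x_0<x_1<\cdots<x_m\}$ be an ordered alphabet, and let $X^*$ be the set of words over $X$, with empty word $\emptyset$ and word length $|\eta|$. A nonempty word $\eta$ is a Lyndon word if $\eta<\nu\xi$ lexicographically for every factorization $\eta=\xi\nu$ into nonempty words; let $L$ be the set of Lyndon words. Let $L^*$ be the set of commutative monomials $l=l_{i_1}\cdots l_{i_k}$ in the elements of $L$ (including the empty monomial), with degree $|l|=|(l_{i_1})|+\cdots+|(l_{i_k})|$, where $(l_i)\in X^*$ denotes $l_i$ viewed as a word, and let $\mathbb R[L]$ be the algebra of commutative polynomials in $L$, constants included. For $u=(u_1,\dots,u_m)\in L_1^m[t_0,t_1]$ and $t\in[t_0,t_1]$ let $E_\emptyset[u](t)=1$ and $E_{x_i\bar\eta}[u](t)=\int_{t_0}^t u_i(\tau)E_{\bar\eta}[u](\tau)\,d\tau$ with $u_0=1$; extend $p\mapsto E_p[u]$ linearly to $p\in\mathbb R\langle X\rangle$. For a series $c=\sum_{\eta\in X^*}(c,\eta)\eta\in\mathbb R\langle\langle X\rangle\rangle$ the Chen–Fliess series is $F_c[u]=\sum_{\eta\in X^*}(c,\eta)E_\eta[u]$.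 A transduction between series over index sets $A$ and $B$ is given by its coefficients $(\tau(a),b)$; here it is called invertible if it has a two-sided inverse and both have only finitely many nonzero coefficients in each row and column. Its adjoint is given by $(\tau^*(b),a)=(\tau(a),b)$, and if $\tau$ is invertible, $\tau^\dagger=(\tau^{-1})^*$. **Theorem.** There is a unique $\mathbb R$-linear map $\mathscr L:\mathbb R\langle X\rangle\to\mathbb R[L]$ with $\mathscr L(\emptyset)=1$, $\mathscr L((l_i))=l_i$ for every Lyndon word, and $\mathscr L(\eta_1\sqcup\!\sqcup\,\eta_2)=\mathscr L(\eta_1)\mathscr L(\eta_2)$ for the shuffle product $\sqcup\!\sqcup$ of any two words. It is bijective and preserves degree, so that $(\mathscr L(c),l)=\sum_{\eta\in X^*}(c,\eta)(\mathscr L(\eta),l)$ is a finite sum for every $c\in\mathbb R\langle\langle X\rangle\rangle$ and $l\in L^*$. The transduction $\tau=\mathscr L^\dagger$ is invertible, with $\tau^\dagger=\mathscr L$ and $\tau^*=\mathscr L^{-1}$. For every $u\in L^m_1[t_0,t_1]$, every $t\in[t_0,t_1]$ and every $l=l_{i_1}\cdots l_{i_k}\in L^*$, $$E_{\mathscr L^{-1}(l)}[u](t)=E_{(l_{i_1})}[u](t)\cdots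 E_{(l_{i_k})}[u](t).$$ For every $c\in\mathbb R\langle\langle X\rangle\rangle$, with $\tau^\dagger(c)=\mathscr L(c)$, $$F_c[u]=\sum_{\eta\in X^*}(c,\eta)E_\eta[u]=\sum_{l\in L^*}(\mathscr L(c),l)\,E_{\mathscr L^{-1}(l)}[u]$$ as an identity of formal (graded) series: for every $k\ge0$, $$\sum_{|\eta|=k}(c,\eta)E_\eta[u](t)=\sum_{|l|=k}(\mathscr L(c),l)E_{\mathscr L^{-1}(l)}[u](t).$$ Consequently, summed by degree, one of the two series converges to $y\in\mathbb R$ at $t$ if and only if the other does; if either series converges absolutely at $t$, then the other one, summed by degree, converges absolutely to the same value; and if both converge absolutely at $t$, their sums are equal. -/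

import Mathlib

open Filter Topology MeasureTheory

/-! ## Words, polynomials and series -/

/-- The alphabet `X = {x₀, x₁, …, x_m}`, with `x₀ < x₁ < ⋯ < x_m`. -/
abbrev Letter (m : ℕ) : Type := Fin (m + 1)

/-- The words `X*`; the empty word is `[]`. -/
abbrev Word (m : ℕ) : Type := List (Letter m)

/-- The noncommutative polynomials `ℝ⟨X⟩`, as a vector space: finitely supported families of
coefficients. The word `η` is `Finsupp.single η 1`. -/
abbrev NCPoly (m : ℕ) : Type := Word m →₀ ℝ

/-- The noncommutative formal power series `ℝ⟨⟨X⟩⟩`: arbitrary families of coefficients. -/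
abbrev NCSeries (m : ℕ) : Type := Word m → ℝ

/-- The shuffle product of two words. -/
noncomputable def shuffle {m : ℕ} : Word m → Word m → NCPoly m
  | [], ξ => Finsupp.single ξ 1
  | i :: η, [] => Finsupp.single (i :: η) 1
  | i :: η, j :: ξ =>
      Finsupp.mapDomain (List.cons i) (shuffle η (j :: ξ)) +
        Finsupp.mapDomain (List.cons j) (shuffle (i :: η) ξ)
termination_by η ξ => η.length + ξ.length

/-! ## Lyndon words and Lyndon monomials -/

/-- A nonempty word is Lyndon if it is lexicographically smaller than each of its proper
rotations. -/
def IsLyndon {m : ℕ} (η : Word m) : Prop :=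
  η ≠ [] ∧ ∀ ξ ν : Word m, ξ ≠ [] → ν ≠ [] → η = ξ ++ ν → η < ν ++ ξ

/-- The set `L` of Lyndon words over `X`. -/
abbrev LyndonWord (m : ℕ) : Type := {η : Word m // IsLyndon η}

/-- The commutative monomials `L*` in the Lyndon words, given by their exponents; `0` is the empty
monomial. -/
abbrev LyndonMonomial (m : ℕ) : Type := LyndonWord m →₀ ℕ

/-- The degree `|l| = |(l_{i₁})| + ⋯ + |(l_{iₖ})|` of a Lyndon monomial. -/
def lyndonDegree {m : ℕ} (l : LyndonMonomial m) : ℕ :=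
  l.sum fun w n => n * w.1.length

theorem finite_lyndonDegree_eq (m k : ℕ) : {l : LyndonMonomial m | lyndonDegree l = k}.Finite := by
  classical
  have hW : {w : LyndonWord m | w.1.length ≤ k}.Finite :=
    Set.Finite.preimage Subtype.val_injective.injOn (List.finite_length_le (Letter m) k)
  refine ((hW.toFinset.finsupp fun _ => Finset.range (k + 1)).finite_toSet).subset ?_
  intro l hl
  have hl' : lyndonDegree l = k := hl
  have key : ∀ w ∈ l.support, l w * w.1.length ≤ k := by
    intro w hw
    rw [← hl']
    exact Finset.single_le_sum (f := fun w : LyndonWord m => l w * w.1.length)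
      (fun _ _ => Nat.zero_le _) hw
  have hpos : ∀ w : LyndonWord m, 0 < w.1.length := fun w => List.length_pos_of_ne_nil w.2.1
  rw [Finset.mem_coe, Finset.mem_finsupp_iff]
  refine ⟨fun w hw => ?_, fun w _ => ?_⟩
  · have h1 : 0 < l w := Nat.pos_of_ne_zero (Finsupp.mem_support_iff.mp hw)
    have h2 : w.1.length ≤ k := le_trans (Nat.le_mul_of_pos_left _ h1) (key w hw)
    simpa using h2
  · rw [Finset.mem_range, Nat.lt_succ_iff]
    by_cases hw : w ∈ l.support
    · exact le_trans (Nat.le_mul_of_pos_right _ (hpos w)) (key w hw)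
    · simp [Finsupp.notMem_support_iff.mp hw]

/-- The finite set of Lyndon monomials of degree `k`. -/
noncomputable def lyndonMonomials (m k : ℕ) : Finset (LyndonMonomial m) :=
  (finite_lyndonDegree_eq m k).toFinset

/-! ## The map `ℒ` -/

/-- The properties that characterize the `ℝ`-linear map `ℒ : ℝ⟨X⟩ → ℝ[L]` from the shuffle algebra
to the commutative polynomials in the Lyndon words. -/
structure IsLyndonMap {m : ℕ} (𝓛 : NCPoly m →ₗ[ℝ] MvPolynomial (LyndonWord m) ℝ) : Prop where
  map_empty : 𝓛 (Finsupp.single [] 1) = 1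
  map_shuffle : ∀ η₁ η₂ : Word m,
    𝓛 (shuffle η₁ η₂) = 𝓛 (Finsupp.single η₁ 1) * 𝓛 (Finsupp.single η₂ 1)
  map_lyndon : ∀ w : LyndonWord m, 𝓛 (Finsupp.single w.1 1) = MvPolynomial.X w

/-! ## Transductions -/

/-- A transduction from series over the words `A` to series over the words `B`, given by its
coefficients `τ a b = (τ(a), b)`. -/
abbrev Transduction (A B : Type) : Type := A → B → ℝ

namespace Transduction

variable {A B : Type}

/-- All row and column sums are finite, so that the transduction and its adjoint act on all formal
series. -/
def IsLocallyFinite (τ : Transduction A B) : Prop :=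
  (∀ a, {b | τ a b ≠ 0}.Finite) ∧ ∀ b, {a | τ a b ≠ 0}.Finite

/-- The image of a series: `(τ(c), b) = ∑ₐ (c, a) (τ(a), b)`. -/
noncomputable def apply (τ : Transduction A B) (c : A → ℝ) : B → ℝ :=
  fun b => ∑ᶠ a, c a * τ a b

/-- The adjoint transduction: `(τ*(b), a) = (τ(a), b)`. -/
def adjoint (τ : Transduction A B) : Transduction B A :=
  fun b a => τ a b

open Classical in
/-- `σ` is the two-sided inverse of `τ`. -/
def IsInverse (τ : Transduction A B) (σ : Transduction B A) : Prop :=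
  τ.IsLocallyFinite ∧ σ.IsLocallyFinite ∧
    (∀ a a', ∑ᶠ b, τ a b * σ b a' = if a = a' then 1 else 0) ∧
    ∀ b b', ∑ᶠ a, σ b a * τ a b' = if b = b' then 1 else 0

open Classical in
/-- The inverse transduction `τ⁻¹` (and `0` if there is none). -/
noncomputable def inverse (τ : Transduction A B) : Transduction B A :=
  if h : ∃ σ, τ.IsInverse σ then h.choose else 0

/-- The dual transduction `τ† = (τ⁻¹)*`. -/
noncomputable def dagger (τ : Transduction A B) : Transduction A B :=
  (inverse τ).adjoint

end Transduction

/-- A linear map `ℝ⟨X⟩ → ℝ[L]` as a transduction from `X` to `L`. -/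
noncomputable def toTransduction {m : ℕ} (𝓛 : NCPoly m →ₗ[ℝ] MvPolynomial (LyndonWord m) ℝ) :
    Transduction (Word m) (LyndonMonomial m) :=
  fun η l => MvPolynomial.coeff l (𝓛 (Finsupp.single η 1))

/-! ## Iterated integrals and Chen–Fliess series -/

/-- The iterated integral `E_η[u](t, t₀)`, where `u₀ = 1` and `u₁, …, u_m` are the components of
the input `u`. -/
noncomputable def iteratedIntegral {m : ℕ} (u : ℝ → Fin m → ℝ) (t₀ : ℝ) : Word m → ℝ → ℝ
  | [], _ => 1
  | i :: η, t =>
      ∫ s in t₀..t, (Fin.cons 1 (u s) : Letter m → ℝ) i * iteratedIntegral u t₀ η s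

/-- The term `(c, η) E_η[u](t, t₀)` of the Chen–Fliess series `F_c[u](t)`. -/
noncomputable def chenFliessTerm {m : ℕ} (c : NCSeries m) (u : ℝ → Fin m → ℝ) (t₀ t : ℝ)
    (η : Word m) : ℝ :=
  c η * iteratedIntegral u t₀ η t

/-- The homogeneous part of length `k` of the Chen–Fliess series `F_c[u](t)`. -/
noncomputable def chenFliessPart {m : ℕ} (c : NCSeries m) (u : ℝ → Fin m → ℝ) (t₀ t : ℝ)
    (k : ℕ) : ℝ :=
  ∑ η : Fin k → Letter m, chenFliessTerm c u t₀ t (List.ofFn η)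

/-- The product `E_{(l_{i₁})}[u] ⋯ E_{(l_{iₖ})}[u]` attached to a Lyndon monomial
`l = l_{i₁} ⋯ l_{iₖ}`. -/
noncomputable def lyndonIntegral {m : ℕ} (u : ℝ → Fin m → ℝ) (t₀ t : ℝ)
    (l : LyndonMonomial m) : ℝ :=
  l.prod fun w n => iteratedIntegral u t₀ w.1 t ^ n

/-- The term of the series indexed by Lyndon monomials with coefficients `d`. -/
noncomputable def lyndonTerm {m : ℕ} (d : LyndonMonomial m → ℝ) (u : ℝ → Fin m → ℝ) (t₀ t : ℝ)
    (l : LyndonMonomial m) : ℝ :=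
  d l * lyndonIntegral u t₀ t l

/-- The homogeneous part of degree `k` of the series indexed by Lyndon monomials. -/
noncomputable def lyndonPart {m : ℕ} (d : LyndonMonomial m → ℝ) (u : ℝ → Fin m → ℝ) (t₀ t : ℝ)
    (k : ℕ) : ℝ :=
  ∑ l ∈ lyndonMonomials m k, lyndonTerm d u t₀ t l

/-! ## Lexicographic order on lists -/

section Lex

variable {α : Type*} [LinearOrder α]

/-! The core is Radford's theorem: the shuffle algebra is the polynomial algebra on the Lyndon
words. By the Chen–Fox–Lyndon factorization, each word is a unique nonincreasing concatenation of
Lyndon words, so `LyndonMonomial.toWord` matches Lyndon monomials with words and degree with length.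
The shuffle product of the factors of `l` is homogeneous, has a positive coefficient at `l.toWord`,
and contains no larger word (`IsShuffle.le_append_flatten`). Hence `lyndonAlgHom`, which sends a
Lyndon variable to its word, is triangular with nonzero diagonal in each degree and therefore
bijective; `ℒ` is its inverse.

At a fixed time the iterated integrals form a character of the shuffle algebra, by integration by
parts (`polyIntegral_shuffle`). Composed with `lyndonAlgHom` it is evaluation of polynomials at the
Lyndon integrals, which gives the product formula. Since `ℒ` is graded, its matrix has finite rows
and columns, and the identity in degree `k` is an exchange of two finite sums
(`chenFliessPart_eq_lyndonPart`). The convergence claims follow by grouping terms by degree. -/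

theorem List.append_lt_append_of_lt_of_not_prefix {x y : List α} (h : x < y) (hp : ¬ x <+: y)
    (r s : List α) : x ++ r < y ++ s := by
  induction x generalizing y with
  | nil => exact absurd (List.nil_prefix) hp
  | cons a x ih =>
    cases y with
    | nil => exact absurd h (List.not_lt_nil _)
    | cons b y =>
      rw [List.cons_lt_cons_iff] at h
      rw [List.cons_append, List.cons_append, List.cons_lt_cons_iff]
      rcases h with h | ⟨rfl, h⟩
      · exact Or.inl h
      · exact Or.inr ⟨rfl, ih h fun h' => hp ((List.prefix_cons_inj a).2 h')⟩

theorem List.append_lt_append_of_lt_of_length_le {x y : List α} (h : x < y)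
    (hl : y.length ≤ x.length) (r s : List α) : x ++ r < y ++ s :=
  List.append_lt_append_of_lt_of_not_prefix h
    (fun hp => h.ne (hp.eq_of_length (le_antisymm hp.length_le hl))) r s

theorem List.cons_le_cons_iff_of_linearOrder {a b : α} {x y : List α} :
    a :: x ≤ b :: y ↔ a < b ∨ a = b ∧ x ≤ y := by
  rw [← not_lt, List.cons_lt_cons_iff]
  rcases lt_trichotomy a b with h | rfl | h
  · simp [h, h.not_gt, h.ne']
  · simp
  · simp [h, h.not_gt, h.ne']

theorem List.le_append_self (x y : List α) : x ≤ x ++ y :=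
  not_lt.1 fun h => List.le_append_left h

theorem List.lt_of_append_left_lt {x y z : List α} (h : x ++ y < x ++ z) : y < z := by
  induction x with
  | nil => exact h
  | cons a x ih => exact ih (by simpa using h)

end Lex

/-! ## The shuffle relation -/

/-- `IsShuffle u v w` says that `w` is obtained by interleaving the words `u` and `v`. -/
inductive IsShuffle {α : Type*} : List α → List α → List α → Prop
  | nil : IsShuffle [] [] []
  | left (a : α) {u v w : List α} : IsShuffle u v w → IsShuffle (a :: u) v (a :: w)
  | right (b : α) {u v w : List α} : IsShuffle u v w → IsShuffle u (b :: v) (b :: w)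

namespace IsShuffle

/-! ### Symmetry and associativity of interleaving -/

section Basic

variable {α : Type*} {u v w x y z : List α}

theorem symm (h : IsShuffle u v w) : IsShuffle v u w := by
  induction h with
  | nil => exact nil
  | left a _ ih => exact ih.right a
  | right b _ ih => exact ih.left b

theorem length_eq (h : IsShuffle u v w) : w.length = u.length + v.length := by
  induction h with
  | nil => rfl
  | left a _ ih => simp only [List.length_cons, ih]; omega
  | right b _ ih => simp only [List.length_cons, ih]; omega

theorem nil_left (v : List α) : IsShuffle [] v v := by
  induction v with
  | nil => exact nil
  | cons b v ih => exact ih.right b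

theorem nil_right (u : List α) : IsShuffle u [] u := (nil_left u).symm

theorem append (u v : List α) : IsShuffle u v (u ++ v) := by
  induction u with
  | nil => exact nil_left v
  | cons a u ih => exact ih.left a

theorem eq_of_nil_left (h : IsShuffle [] v w) : w = v := by
  induction v generalizing w with
  | nil => cases h; rfl
  | cons b v ih => cases h with
    | right _ h => rw [ih h]

theorem eq_of_nil_right (h : IsShuffle u [] w) : w = u := h.symm.eq_of_nil_left

theorem assoc (h : IsShuffle u y w) (h' : IsShuffle v z y) :
    ∃ x, IsShuffle u v x ∧ IsShuffle x z w := by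
  induction h generalizing v z with
  | nil => cases h'; exact ⟨[], nil, nil⟩
  | left a _ ih =>
    obtain ⟨x, h1, h2⟩ := ih h'
    exact ⟨a :: x, h1.left a, h2.left a⟩
  | right b _ ih =>
    cases h' with
    | left _ h' =>
      obtain ⟨x, h1, h2⟩ := ih h'
      exact ⟨b :: x, h1.right b, h2.left b⟩
    | right _ h' =>
      obtain ⟨x, h1, h2⟩ := ih h'
      exact ⟨x, h1, h2.right b⟩

theorem assoc' (h : IsShuffle x z w) (h' : IsShuffle u v x) :
    ∃ y, IsShuffle v z y ∧ IsShuffle u y w := by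
  obtain ⟨y, h1, h2⟩ := h.symm.assoc h'.symm
  exact ⟨y, h1.symm, h2.symm⟩

end Basic

/-! ### Lexicographic comparison of interleavings -/

section Order

variable {α : Type*} [LinearOrder α] {u v w : List α}

/-- The larger of two words should be read first: moving a prefix `p` from the larger word `u` to
the smaller word `v` does not decrease the shuffles. -/
theorem exists_ge_of_le {p : List α} (hvu : v ≤ u) (h : IsShuffle (p ++ u) v w) :
    ∃ w', IsShuffle u (p ++ v) w' ∧ w ≤ w' := by
  induction w generalizing p u v with
  | nil =>
    have := h.length_eq
    simp only [List.length_nil, List.length_append] at this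
    obtain rfl : p = [] := List.eq_nil_of_length_eq_zero (by omega)
    exact ⟨_, h, le_rfl⟩
  | cons a w ih =>
    rcases p with _ | ⟨c, p⟩
    · exact ⟨_, h, le_rfl⟩
    · cases h with
      | left _ h =>
        obtain ⟨w', h1, h2⟩ := ih hvu h
        exact ⟨_, h1.right a, List.cons_le_cons _ h2⟩
      | @right _ _ v' _ h =>
        rcases u with _ | ⟨d, u⟩
        · exact absurd hvu (not_le.2 (List.nil_lt_cons _ _))
        · rcases List.cons_le_cons_iff_of_linearOrder.1 hvu with hlt | ⟨rfl, hle⟩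
          -- Any interleaving that starts with the larger letter `d` wins.
          · exact ⟨_, append _ _, List.cons_le_cons_iff_of_linearOrder.2 (Or.inl hlt)⟩
          -- The common letter is now read from `u`; the copy that `v` keeps is absorbed into the
          -- moved prefix.
          · obtain ⟨w', h1, h2⟩ := ih (p := c :: p ++ [a]) hle (by simpa using h)
            exact ⟨a :: w', by simpa using h1.left a, List.cons_le_cons _ h2⟩

/-- The same interleaving pattern is followed until `v` and `v'` first differ; there the larger
letter of `v'` decides, and the rest may be interleaved arbitrarily. -/
theorem exists_ge_right {v' : List α} (h : IsShuffle u v w) (hv : v ≤ v')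
    (hl : v.length = v'.length) : ∃ w', IsShuffle u v' w' ∧ w ≤ w' := by
  induction h generalizing v' with
  | nil =>
    obtain rfl : v' = [] := List.eq_nil_of_length_eq_zero hl.symm
    exact ⟨[], nil, le_rfl⟩
  | left a _ ih =>
    obtain ⟨w', h1, h2⟩ := ih hv hl
    exact ⟨a :: w', h1.left a, List.cons_le_cons _ h2⟩
  | @right b u v w h ih =>
    rcases v' with _ | ⟨c, v'⟩
    · simp at hl
    · rcases List.cons_le_cons_iff_of_linearOrder.1 hv with hlt | ⟨rfl, hle⟩
      · exact ⟨c :: (u ++ v'), (append _ _).right c,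
          List.cons_le_cons_iff_of_linearOrder.2 (Or.inl hlt)⟩
      · obtain ⟨w', h1, h2⟩ := ih hle (by simpa using hl)
        exact ⟨b :: w', h1.right b, List.cons_le_cons _ h2⟩

theorem exists_ge_left {u' : List α} (h : IsShuffle u v w) (hu : u ≤ u')
    (hl : u.length = u'.length) : ∃ w', IsShuffle u' v w' ∧ w ≤ w' := by
  obtain ⟨w', h1, h2⟩ := h.symm.exists_ge_right hu hl
  exact ⟨w', h1.symm, h2⟩

/-- For a nonincreasing list of words that are minimal among their nonempty suffixes, the
concatenation is the largest shuffle. -/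
theorem le_append_flatten {L : List (List α)} (hne : ∀ l ∈ L, l ≠ [])
    (hsuf : ∀ l ∈ L, ∀ t, t ≠ [] → t <:+ l → l ≤ t) (hL : L.Pairwise (· ≥ ·)) {s : List α}
    (hs : ∀ t, t ≠ [] → t <:+ s → ∀ l ∈ L, l ≤ t) (h : IsShuffle s L.flatten w) :
    w ≤ s ++ L.flatten := by
  induction L generalizing s w with
  | nil =>
    rw [List.flatten_nil] at h
    simp [h.eq_of_nil_right]
  | cons l L ihL =>
    -- `s` is what remains of the current factor, so the inner induction consumes it letter by
    -- letter.
    induction s generalizing w with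
    | nil => exact h.eq_of_nil_left.le
    | cons a s ihs =>
      have hs' : ∀ t, t ≠ [] → t <:+ s → ∀ l' ∈ l :: L, l' ≤ t := fun t ht hts =>
        hs t ht (hts.trans (List.suffix_cons a s))
      obtain ⟨b, l, rfl⟩ := List.exists_cons_of_ne_nil (hne l List.mem_cons_self)
      rw [List.flatten_cons, List.cons_append] at h
      rw [List.cons_append]
      cases h with
      | left _ h => exact List.cons_le_cons _ (ihs hs' h)
      | right _ h =>
        have hls : b :: l ≤ a :: s :=
          hs _ (List.cons_ne_nil _ _) List.suffix_rfl _ List.mem_cons_self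
        rcases List.cons_le_cons_iff_of_linearOrder.1 hls with hlt | ⟨rfl, hle⟩
        · exact List.cons_le_cons_iff_of_linearOrder.2 (Or.inl hlt)
        · refine List.cons_le_cons _ ?_
          -- The first letter came from the next factor, but `s` starts with the same letter `b`.
          -- Exchanging the two copies inside the interleaving with `l` does not decrease the word,
          -- and leaves `s` against an interleaving `y` of the intact factor `b :: l` with the rest.
          obtain ⟨x, hx, hxw⟩ := h.assoc (append l L.flatten)
          obtain ⟨x', hx', hxx'⟩ := exists_ge_of_le (p := [b]) hle hx
          obtain ⟨w₁, hw₁, hww₁⟩ := hxw.exists_ge_left hxx' (by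
            rw [hx.length_eq, hx'.length_eq]
            simp only [List.length_cons, List.length_append, List.length_nil]
            omega)
          obtain ⟨y, hy, hyw⟩ := hw₁.assoc' hx'
          rw [List.pairwise_cons] at hL
          -- The outer induction bounds `y` with `b :: l` in the role of `s`; then `y` may be
          -- replaced by its bound.
          have hyle : y ≤ (b :: l) ++ L.flatten :=
            ihL (fun l' hl' => hne l' (List.mem_cons_of_mem _ hl'))
              (fun l' hl' => hsuf l' (List.mem_cons_of_mem _ hl')) hL.2
              (fun t ht hts l' hl' =>
                (hL.1 l' hl').trans (hsuf _ List.mem_cons_self t ht hts)) hy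
          obtain ⟨w₂, hw₂, hww₂⟩ := hyw.exists_ge_right hyle (by
            rw [hy.length_eq]
            simp only [List.length_cons, List.length_append, List.length_nil]
            omega)
          exact hww₁.trans (hww₂.trans (ihs hs' hw₂))

end Order

end IsShuffle

/-! ## Lyndon words -/

namespace IsLyndon

variable {m : ℕ} {η ξ : Word m}

/-- Write `η = ξν` and suppose `ν < η`. If `ν` is not a prefix of `η`, a letter decides and `νξ < η`
contradicts the rotation condition. If `η = νξ'`, the rotation `νξ` gives `ξ' < ξ`, hence `ξ'ν < ξν
= η`, while `ξ'ν` is itself a rotation of `η`. -/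
theorem lt_of_suffix (h : IsLyndon η) {ν : Word m} (hν : ν ≠ []) (hs : ν <:+ η) (hne : ν ≠ η) :
    η < ν := by
  obtain ⟨ξ, rfl⟩ := hs
  have hξ : ξ ≠ [] := fun h => hne (by simp [h])
  have hrot : ξ ++ ν < ν ++ ξ := h.2 ξ ν hξ hν rfl
  by_contra hlt
  rcases (not_lt.1 hlt).lt_or_eq with hlt | heq
  · by_cases hp : ν <+: ξ ++ ν
    · obtain ⟨ξ', hξ'⟩ := hp
      have hl : ξ'.length = ξ.length := by
        have := congrArg List.length hξ'
        simp only [List.length_append] at this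
        omega
      have h1 : ξ' < ξ := by
        rw [← hξ'] at hrot
        exact List.lt_of_append_left_lt hrot
      have h2 : ξ' ++ ν < ξ ++ ν := List.append_lt_append_of_lt_of_length_le h1 hl.ge _ _
      have h3 : ξ ++ ν < ξ' ++ ν :=
        h.2 ν ξ' hν (fun h0 => hξ (List.eq_nil_of_length_eq_zero (by rw [← hl, h0]; rfl))) hξ'.symm
      exact lt_asymm h2 h3
    · have := List.append_lt_append_of_lt_of_not_prefix hlt hp ξ []
      rw [List.append_nil] at this
      exact lt_asymm this hrot
  · exact hne heq

theorem le_of_suffix (h : IsLyndon η) {ν : Word m} (hν : ν ≠ []) (hs : ν <:+ η) : η ≤ ν := by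
  rcases eq_or_ne ν η with rfl | hne
  · exact le_rfl
  · exact (h.lt_of_suffix hν hs hne).le

theorem of_lt_suffix (hη : η ≠ []) (h : ∀ ν, ν ≠ [] → ν <:+ η → ν ≠ η → η < ν) : IsLyndon η := by
  refine ⟨hη, fun ξ ν hξ hν he => ?_⟩
  refine (h ν hν ⟨ξ, he.symm⟩ fun h' => hξ ?_).trans_le (List.le_append_self _ _)
  rw [← h'] at he
  exact List.self_eq_append_left.1 he

theorem singleton (a : Letter m) : IsLyndon [a] := by
  refine of_lt_suffix (List.cons_ne_nil _ _) fun ν hν hs hne => ?_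
  rcases List.suffix_cons_iff.1 hs with h | h
  · exact absurd h hne
  · exact absurd (List.suffix_nil.1 h) hν

theorem append_lt (hη : IsLyndon η) (hξ : IsLyndon ξ) (h : η < ξ) : η ++ ξ < ξ := by
  by_cases hp : η <+: ξ
  · obtain ⟨ν, rfl⟩ := hp
    refine List.append_left_lt (hξ.lt_of_suffix ?_ (List.suffix_append _ _) ?_)
    · rintro rfl
      simp at h
    · intro h'
      exact hη.1 (List.self_eq_append_left.1 h')
  · simpa using List.append_lt_append_of_lt_of_not_prefix h hp ξ []

/-- A proper suffix is either `tξ` with `t` a suffix of `η`, where a nonempty proper `t` already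
exceeds `η` without being longer, or a suffix of `ξ`, which is at least `ξ > ηξ`. -/
theorem append (hη : IsLyndon η) (hξ : IsLyndon ξ) (h : η < ξ) : IsLyndon (η ++ ξ) := by
  have hlt := hη.append_lt hξ h
  refine of_lt_suffix (by simp [hη.1]) fun ν hν hs hne => ?_
  obtain ⟨r, hr⟩ := hs
  rcases List.append_eq_append_iff.1 hr with ⟨t, ht, rfl⟩ | ⟨t, -, ht⟩
  · rcases eq_or_ne t [] with rfl | ht0
    · simpa using hlt
    · have hne' : t ≠ η := fun h' => hne (by rw [h'])
      exact List.append_lt_append_of_lt_of_length_le (hη.lt_of_suffix ht0 ⟨r, ht.symm⟩ hne')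
        (List.IsSuffix.length_le ⟨r, ht.symm⟩) _ _
  · exact hlt.trans_le (hξ.le_of_suffix hν ⟨t, ht.symm⟩)

end IsLyndon

/-! ## Lyndon factorizations -/

/-- The word spelled by a list of Lyndon words. -/
def lyndonFlatten {m : ℕ} (L : List (LyndonWord m)) : Word m := (L.map Subtype.val).flatten

section Factorization

variable {m : ℕ}

@[simp] theorem lyndonFlatten_nil : lyndonFlatten ([] : List (LyndonWord m)) = [] := rfl

@[simp] theorem lyndonFlatten_cons (w : LyndonWord m) (L : List (LyndonWord m)) :
    lyndonFlatten (w :: L) = w.1 ++ lyndonFlatten L := by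
  simp [lyndonFlatten]

/-- If `w` is smaller than the first factor, the two merge into one Lyndon word, and the insertion
continues with the shorter list. -/
theorem exists_lyndonFlatten_eq_append (w : LyndonWord m) {L : List (LyndonWord m)}
    (hL : L.Pairwise (· ≥ ·)) :
    ∃ L' : List (LyndonWord m), L'.Pairwise (· ≥ ·) ∧ lyndonFlatten L' = w.1 ++ lyndonFlatten L := by
  induction L generalizing w with
  | nil => exact ⟨[w], List.pairwise_singleton _ _, by simp⟩
  | cons v L ih =>
    rcases le_or_gt v w with h | h
    · refine ⟨w :: v :: L, List.pairwise_cons.2 ⟨fun x hx => ?_, hL⟩, by simp⟩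
      rcases List.mem_cons.1 hx with rfl | hx
      · exact h
      · exact ((List.pairwise_cons.1 hL).1 x hx).trans h
    · obtain ⟨L', h1, h2⟩ := ih ⟨w.1 ++ v.1, w.2.append v.2 h⟩ (List.pairwise_cons.1 hL).2
      exact ⟨L', h1, by simp [h2]⟩

/-- Every word is a nonincreasing product of Lyndon words. -/
theorem exists_lyndonFlatten_eq (η : Word m) :
    ∃ L : List (LyndonWord m), L.Pairwise (· ≥ ·) ∧ lyndonFlatten L = η := by
  induction η with
  | nil => exact ⟨[], List.Pairwise.nil, rfl⟩
  | cons a η ih =>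
    obtain ⟨L, h1, rfl⟩ := ih
    exact exists_lyndonFlatten_eq_append ⟨[a], IsLyndon.singleton a⟩ h1

/-- A prefix `s` would either be a prefix of the first factor, hence at most that factor, or extend
it by a nonempty suffix of `s` to which induction applies. -/
theorem not_prefix_lyndonFlatten {s : Word m} (hs0 : s ≠ []) {L : List (LyndonWord m)}
    (hs : ∀ t, t ≠ [] → t <:+ s → ∀ l ∈ L, l.1 < t) : ¬ s <+: lyndonFlatten L := by
  induction L generalizing s with
  | nil => simpa using hs0
  | cons v L ih =>
    rw [lyndonFlatten_cons]
    have hv : v.1 < s := hs s hs0 List.suffix_rfl v List.mem_cons_self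
    rintro ⟨r, hr⟩
    rcases List.append_eq_append_iff.1 hr with ⟨t, ht, -⟩ | ⟨t, rfl, ht⟩
    · exact absurd hv (not_lt.2 (ht ▸ List.le_append_self _ _))
    · refine ih (s := t) ?_ (fun q hq hqt l hl =>
        hs q hq (hqt.trans (List.suffix_append _ _)) l (List.mem_cons_of_mem _ hl)) ⟨r, ht.symm⟩
      rintro rfl
      simp at hv

/-- Were `w = vs` longer, `s` would be a prefix of the remaining factors; but each nonempty suffix
of `s` is a proper suffix of `w`, so it exceeds `w ≥ v` and all those factors. -/
theorem lyndonFlatten_cons_length_le {v w : LyndonWord m} {L L' : List (LyndonWord m)}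
    (hL : (v :: L).Pairwise (· ≥ ·)) (h : lyndonFlatten (v :: L) = lyndonFlatten (w :: L')) :
    w.1.length ≤ v.1.length := by
  by_contra! hlt
  rw [lyndonFlatten_cons, lyndonFlatten_cons] at h
  obtain ⟨s, hs⟩ : v.1 <+: w.1 :=
    List.prefix_of_prefix_length_le (List.prefix_append _ _) 
      (h.symm ▸ List.prefix_append _ _) hlt.le
  have hs0 : s ≠ [] := by
    rintro rfl
    rw [← hs] at hlt
    simp at hlt
  rw [← hs, List.append_assoc, List.append_cancel_left_eq] at h
  refine not_prefix_lyndonFlatten hs0 (fun t ht hts l hl => ?_) (h ▸ List.prefix_append _ _)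
  have h1 : w.1 < t := by
    refine w.2.lt_of_suffix ht (hts.trans ⟨v.1, hs⟩) fun h' => ?_
    have h2 := hts.length_le
    rw [h', ← hs, List.length_append] at h2
    have h3 := List.length_pos_of_ne_nil v.2.1
    omega
  have h4 : v.1 ≤ w.1 := hs ▸ List.le_append_self _ _
  exact (show l.1 ≤ v.1 from (List.pairwise_cons.1 hL).1 l hl).trans_lt (h4.trans_lt h1)

/-- The factorization of a word into a nonincreasing product of Lyndon words is unique. -/
theorem lyndonFlatten_injOn {L L' : List (LyndonWord m)} (hL : L.Pairwise (· ≥ ·))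
    (hL' : L'.Pairwise (· ≥ ·)) (h : lyndonFlatten L = lyndonFlatten L') : L = L' := by
  induction L generalizing L' with
  | nil =>
    cases L' with
    | nil => rfl
    | cons w L' => simp [eq_comm, w.2.1] at h
  | cons v L ih =>
    cases L' with
    | nil => simp [v.2.1] at h
    | cons w L' =>
      have hl : v.1.length = w.1.length :=
        le_antisymm (lyndonFlatten_cons_length_le hL' h.symm) (lyndonFlatten_cons_length_le hL h)
      rw [lyndonFlatten_cons, lyndonFlatten_cons] at h
      obtain ⟨h1, h2⟩ := List.append_inj h hl
      rw [Subtype.ext h1, ih (List.pairwise_cons.1 hL).2 (List.pairwise_cons.1 hL').2 h2]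

/-- The word obtained by concatenating the factors of a Lyndon monomial in nonincreasing order. -/
noncomputable def LyndonMonomial.toWord (l : LyndonMonomial m) : Word m :=
  lyndonFlatten ((Finsupp.toMultiset l).sort (· ≥ ·))

theorem LyndonMonomial.toWord_injective :
    Function.Injective (LyndonMonomial.toWord (m := m)) := by
  intro l l' h
  have := lyndonFlatten_injOn (Multiset.pairwise_sort ..) (Multiset.pairwise_sort ..) h
  apply Multiset.toFinsupp.symm.injective
  change Finsupp.toMultiset l = Finsupp.toMultiset l'
  rw [← Multiset.sort_eq (Finsupp.toMultiset l) (· ≥ ·), this, Multiset.sort_eq]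

theorem LyndonMonomial.toWord_surjective :
    Function.Surjective (LyndonMonomial.toWord (m := m)) := by
  classical
  intro η
  obtain ⟨L, h1, rfl⟩ := exists_lyndonFlatten_eq η
  refine ⟨Multiset.toFinsupp (L : Multiset (LyndonWord m)), ?_⟩
  rw [LyndonMonomial.toWord, Multiset.toFinsupp_toMultiset]
  congr 1
  exact List.Perm.eq_of_pairwise' (Multiset.pairwise_sort ..) h1
    (Multiset.coe_eq_coe.1 (Multiset.sort_eq ..))

theorem length_lyndonFlatten (L : List (LyndonWord m)) :
    (lyndonFlatten L).length = (L.map fun w => w.1.length).sum := by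
  simp [lyndonFlatten, List.length_flatten]

theorem LyndonMonomial.length_toWord (l : LyndonMonomial m) :
    l.toWord.length = lyndonDegree l := by
  rw [LyndonMonomial.toWord, length_lyndonFlatten, ← Multiset.sum_coe, ← Multiset.map_coe,
    Multiset.sort_eq, Finsupp.toMultiset_map, lyndonDegree,
    Finsupp.sum_toMultiset, Finsupp.sum_mapDomain_index (by simp) (by simp [add_mul])]
  rfl

end Factorization

/-! ## The shuffle algebra -/

section ShuffleProduct

variable {m : ℕ}

theorem shuffle_nil_left (ξ : Word m) : shuffle [] ξ = Finsupp.single ξ 1 := by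
  rw [shuffle]

theorem shuffle_nil_right (η : Word m) : shuffle η [] = Finsupp.single η 1 := by
  cases η <;> rw [shuffle]

theorem shuffle_cons_cons (i j : Letter m) (η ξ : Word m) :
    shuffle (i :: η) (j :: ξ) = Finsupp.mapDomain (List.cons i) (shuffle η (j :: ξ)) +
      Finsupp.mapDomain (List.cons j) (shuffle (i :: η) ξ) := by
  rw [shuffle]

/-- Left concatenation of a letter. -/
noncomputable def consLin (i : Letter m) : NCPoly m →ₗ[ℝ] NCPoly m :=
  Finsupp.lmapDomain ℝ ℝ (List.cons i)

@[simp] theorem consLin_single (i : Letter m) (η : Word m) (a : ℝ) :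
    consLin i (Finsupp.single η a) = Finsupp.single (i :: η) a :=
  Finsupp.mapDomain_single

/-- The bilinear extension of the shuffle product. -/
noncomputable def shuffleBilin (m : ℕ) : NCPoly m →ₗ[ℝ] NCPoly m →ₗ[ℝ] NCPoly m :=
  Finsupp.linearCombination ℝ fun η => Finsupp.linearCombination ℝ (shuffle η)

theorem shuffleBilin_single_single (η ξ : Word m) (a b : ℝ) :
    shuffleBilin m (Finsupp.single η a) (Finsupp.single ξ b) = (a * b) • shuffle η ξ := by
  simp [shuffleBilin, Finsupp.linearCombination_single, mul_smul]

theorem shuffleBilin_nil_left (p : NCPoly m) : shuffleBilin m (Finsupp.single [] 1) p = p := by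
  induction p using Finsupp.induction_linear with
  | zero => simp
  | add p q hp hq => rw [map_add, hp, hq]
  | single ξ b => simp [shuffleBilin_single_single, shuffle_nil_left]

theorem shuffle_comm (η ξ : Word m) : shuffle η ξ = shuffle ξ η := by
  induction η, ξ using shuffle.induct with
  | case1 ξ => rw [shuffle_nil_left, shuffle_nil_right]
  | case2 i η => rw [shuffle_nil_left, shuffle_nil_right]
  | case3 i η j ξ ih1 ih2 => rw [shuffle_cons_cons, shuffle_cons_cons j i, ih1, ih2, add_comm]

theorem shuffleBilin_comm (p q : NCPoly m) : shuffleBilin m p q = shuffleBilin m q p := by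
  induction p using Finsupp.induction_linear with
  | zero => simp
  | add p p' hp hp' => rw [map_add, map_add, LinearMap.add_apply, hp, hp']
  | single η a =>
    induction q using Finsupp.induction_linear with
    | zero => simp
    | add q q' hq hq' => rw [map_add, map_add, LinearMap.add_apply, hq, hq']
    | single ξ b => rw [shuffleBilin_single_single, shuffleBilin_single_single, shuffle_comm,
        mul_comm]

theorem shuffleBilin_nil_right (p : NCPoly m) : shuffleBilin m p (Finsupp.single [] 1) = p := by
  rw [shuffleBilin_comm, shuffleBilin_nil_left]

theorem shuffleBilin_cons_cons (i j : Letter m) (p q : NCPoly m) :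
    shuffleBilin m (consLin i p) (consLin j q) =
      consLin i (shuffleBilin m p (consLin j q)) + consLin j (shuffleBilin m (consLin i p) q) := by
  induction p using Finsupp.induction_linear with
  | zero => simp
  | add p p' hp hp' =>
    simp only [map_add, LinearMap.add_apply, hp, hp']
    abel
  | single η a =>
    induction q using Finsupp.induction_linear with
    | zero => simp
    | add q q' hq hq' =>
      simp only [map_add, hq, hq']
      abel
    | single ξ b =>
      simp only [consLin_single, shuffleBilin_single_single, map_smul, shuffle_cons_cons, smul_add]
      rfl

theorem shuffleBilin_assoc_word (η ξ ζ : Word m) :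
    shuffleBilin m (shuffleBilin m (Finsupp.single η 1) (Finsupp.single ξ 1))
        (Finsupp.single ζ 1) =
      shuffleBilin m (Finsupp.single η 1)
        (shuffleBilin m (Finsupp.single ξ 1) (Finsupp.single ζ 1)) := by
  rcases η with _ | ⟨i, η⟩
  · simp only [shuffleBilin_nil_left]
  rcases ξ with _ | ⟨j, ξ⟩
  · simp only [shuffleBilin_nil_left, shuffleBilin_nil_right]
  rcases ζ with _ | ⟨k, ζ⟩
  · simp only [shuffleBilin_nil_right]
  have h1 := shuffleBilin_assoc_word η (j :: ξ) (k :: ζ)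
  have h2 := shuffleBilin_assoc_word (i :: η) ξ (k :: ζ)
  have h3 := shuffleBilin_assoc_word (i :: η) (j :: ξ) ζ
  simp only [← consLin_single] at h1 h2 h3 ⊢
  simp only [shuffleBilin_cons_cons, map_add, LinearMap.add_apply] at h1 h2 h3 ⊢
  -- Both sides split according to which of `i`, `j`, `k` is read first; each part is a shorter
  -- instance of associativity.
  have e1 := congrArg (consLin i) h1
  have e2 := congrArg (consLin j) h2
  have e3 := congrArg (consLin k) h3
  simp only [map_add] at e1 e2 e3
  linear_combination (norm := abel) e1 + e2 + e3
termination_by η.length + ξ.length + ζ.length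

theorem shuffleBilin_assoc (p q r : NCPoly m) :
    shuffleBilin m (shuffleBilin m p q) r = shuffleBilin m p (shuffleBilin m q r) := by
  induction p using Finsupp.induction_linear with
  | zero => simp
  | add p p' hp hp' => simp only [map_add, LinearMap.add_apply, hp, hp']
  | single η a =>
    induction q using Finsupp.induction_linear with
    | zero => simp
    | add q q' hq hq' => simp only [map_add, LinearMap.add_apply, hq, hq']
    | single ξ b =>
      induction r using Finsupp.induction_linear with
      | zero => simp
      | add r r' hr hr' => simp only [map_add, hr, hr']
      | single ζ c =>
        have h := congrArg (fun p => (a * b * c) • p) (shuffleBilin_assoc_word η ξ ζ)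
        rw [← mul_one a, ← mul_one b, ← mul_one c, ← smul_eq_mul a, ← smul_eq_mul b,
          ← smul_eq_mul c, ← Finsupp.smul_single, ← Finsupp.smul_single, ← Finsupp.smul_single]
        simp only [map_smul, LinearMap.smul_apply, smul_smul] at h ⊢
        convert h using 2 <;> ring

end ShuffleProduct

/-- The space `ℝ⟨X⟩` with the shuffle product. -/
def ShuffleAlgebra (m : ℕ) : Type := NCPoly m

namespace ShuffleAlgebra

variable {m : ℕ}

noncomputable instance : AddCommGroup (ShuffleAlgebra m) := inferInstanceAs (AddCommGroup (NCPoly m))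

noncomputable instance : Module ℝ (ShuffleAlgebra m) := inferInstanceAs (Module ℝ (NCPoly m))

noncomputable instance : CommRing (ShuffleAlgebra m) :=
  { (inferInstance : AddCommGroup (ShuffleAlgebra m)) with
    mul := fun p q => shuffleBilin m p q
    one := (Finsupp.single [] 1 : NCPoly m)
    left_distrib := fun p q r => map_add (shuffleBilin m p) q r
    right_distrib := fun p q r => LinearMap.map_add₂ (shuffleBilin m) p q r
    zero_mul := fun p => LinearMap.map_zero₂ (shuffleBilin m) p
    mul_zero := fun p => map_zero (shuffleBilin m p)
    mul_assoc := shuffleBilin_assoc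
    one_mul := shuffleBilin_nil_left
    mul_one := shuffleBilin_nil_right
    mul_comm := shuffleBilin_comm }

noncomputable instance : Algebra ℝ (ShuffleAlgebra m) :=
  Algebra.ofModule (fun a p q => LinearMap.map_smul₂ (shuffleBilin m) a p q)
    (fun a p q => map_smul (shuffleBilin m p) a q)

/-- The identity map from the shuffle algebra to the space `ℝ⟨X⟩`. -/
noncomputable def toNCPoly : ShuffleAlgebra m ≃ₗ[ℝ] NCPoly m := LinearEquiv.refl ℝ (NCPoly m)

/-- A word as an element of the shuffle algebra. -/
noncomputable def word (η : Word m) : ShuffleAlgebra m := toNCPoly.symm (Finsupp.single η 1)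

theorem toNCPoly_word (η : Word m) : toNCPoly (word η) = Finsupp.single η 1 := rfl

theorem toNCPoly_one : toNCPoly (1 : ShuffleAlgebra m) = Finsupp.single [] 1 := rfl

theorem toNCPoly_mul (p q : ShuffleAlgebra m) :
    toNCPoly (p * q) = shuffleBilin m (toNCPoly p) (toNCPoly q) := rfl

theorem toNCPoly_word_mul (η : Word m) (p : ShuffleAlgebra m) :
    toNCPoly (word η * p) = (toNCPoly p).sum fun ξ a => a • shuffle η ξ := by
  rw [toNCPoly_mul, toNCPoly_word, shuffleBilin, Finsupp.linearCombination_single, one_smul]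
  rfl

theorem word_mul_word (η ξ : Word m) : word η * word ξ = toNCPoly.symm (shuffle η ξ) := by
  apply toNCPoly.injective
  rw [toNCPoly_mul, toNCPoly_word, toNCPoly_word, shuffleBilin_single_single, one_mul, one_smul,
    LinearEquiv.apply_symm_apply]

/-- An `ℝ`-linear map that is multiplicative on words is an algebra homomorphism. -/
noncomputable def liftAlgHom {A : Type*} [CommRing A] [Algebra ℝ A] (f : NCPoly m →ₗ[ℝ] A)
    (h1 : f (Finsupp.single [] 1) = 1)
    (hmul : ∀ η ξ, f (shuffle η ξ) = f (Finsupp.single η 1) * f (Finsupp.single ξ 1)) :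
    ShuffleAlgebra m →ₐ[ℝ] A :=
  AlgHom.ofLinearMap (f ∘ₗ toNCPoly.toLinearMap) h1 fun p q => by
    have h : (shuffleBilin m).compr₂ f = (LinearMap.mul ℝ A).compl₁₂ f f := by
      ext η ξ
      simp [shuffleBilin_single_single, hmul]
    exact LinearMap.congr_fun₂ h p q

theorem liftAlgHom_apply {A : Type*} [CommRing A] [Algebra ℝ A] (f : NCPoly m →ₗ[ℝ] A)
    (h1 : f (Finsupp.single [] 1) = 1)
    (hmul : ∀ η ξ, f (shuffle η ξ) = f (Finsupp.single η 1) * f (Finsupp.single ξ 1))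
    (p : ShuffleAlgebra m) : liftAlgHom f h1 hmul p = f (toNCPoly p) := rfl

end ShuffleAlgebra

/-! ## Coefficients of shuffles -/

section Coefficients

variable {m : ℕ}

theorem mapDomain_cons_apply (i : Letter m) (p : NCPoly m) (j : Letter m) (w : Word m) :
    Finsupp.mapDomain (List.cons i) p (j :: w) = if i = j then p w else 0 := by
  split_ifs with h
  · subst h
    exact Finsupp.mapDomain_apply (List.cons_injective) p w
  · refine Finsupp.mapDomain_of_notMem_range p _ ?_
    rintro ⟨x, hx⟩
    exact h (List.cons_eq_cons.1 hx).1

theorem mapDomain_cons_apply_nil (i : Letter m) (p : NCPoly m) :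
    Finsupp.mapDomain (List.cons i) p [] = 0 := by
  refine Finsupp.mapDomain_of_notMem_range p _ ?_
  rintro ⟨x, hx⟩
  exact List.cons_ne_nil _ _ hx

/-- Nonnegativity rules out cancellation, so that the leading coefficient in
`lyndonShuffle_lyndonFlatten_pos` stays positive. -/
theorem shuffle_nonneg (η ξ w : Word m) : 0 ≤ shuffle η ξ w := by
  induction η, ξ using shuffle.induct generalizing w with
  | case1 ξ => rw [shuffle_nil_left, Finsupp.single_apply]; split_ifs <;> norm_num
  | case2 i η => rw [shuffle_nil_right, Finsupp.single_apply]; split_ifs <;> norm_num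
  | case3 i η j ξ ih1 ih2 =>
    rw [shuffle_cons_cons, Finsupp.add_apply]
    cases w with
    | nil => simp [mapDomain_cons_apply_nil]
    | cons k w =>
      rw [mapDomain_cons_apply, mapDomain_cons_apply]
      refine add_nonneg ?_ ?_ <;> split_ifs
      exacts [ih1 w, le_rfl, ih2 w, le_rfl]

theorem isShuffle_of_shuffle_ne_zero {η ξ w : Word m} (h : shuffle η ξ w ≠ 0) :
    IsShuffle η ξ w := by
  induction η, ξ using shuffle.induct generalizing w with
  | case1 ξ =>
    rw [shuffle_nil_left, Finsupp.single_apply_ne_zero] at h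
    rw [h.1]
    exact IsShuffle.nil_left ξ
  | case2 i η =>
    rw [shuffle_nil_right, Finsupp.single_apply_ne_zero] at h
    rw [h.1]
    exact IsShuffle.nil_right _
  | case3 i η j ξ ih1 ih2 =>
    rw [shuffle_cons_cons, Finsupp.add_apply] at h
    cases w with
    | nil => simp [mapDomain_cons_apply_nil] at h
    | cons k w =>
      rw [mapDomain_cons_apply, mapDomain_cons_apply] at h
      by_cases h1 : (if i = k then shuffle η (j :: ξ) w else 0) = 0
      · rw [h1, zero_add, ite_ne_right_iff] at h
        obtain ⟨rfl, h⟩ := h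
        exact (ih2 h).right j
      · rw [← ne_eq, ite_ne_right_iff] at h1
        obtain ⟨rfl, h1⟩ := h1
        exact (ih1 h1).left i

theorem shuffle_append_pos (η ξ : Word m) : 0 < shuffle η ξ (η ++ ξ) := by
  induction η, ξ using shuffle.induct with
  | case1 ξ => simp [shuffle_nil_left]
  | case2 i η => simp [shuffle_nil_right]
  | case3 i η j ξ ih1 ih2 =>
    rw [shuffle_cons_cons, Finsupp.add_apply, List.cons_append, mapDomain_cons_apply, if_pos rfl,
      mapDomain_cons_apply]
    refine add_pos_of_pos_of_nonneg ih1 ?_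
    split_ifs
    exacts [shuffle_nonneg _ _ _, le_rfl]

end Coefficients

/-! ## Triangularity of the shuffle products of Lyndon words -/

section Triangularity

open ShuffleAlgebra

variable {m : ℕ}

/-- The shuffle product of a list of Lyndon words. -/
noncomputable def lyndonShuffle (L : List (LyndonWord m)) : ShuffleAlgebra m :=
  (L.map fun w => word w.1).prod

theorem toNCPoly_lyndonShuffle_cons_apply (v : LyndonWord m) (L : List (LyndonWord m))
    (w : Word m) : toNCPoly (lyndonShuffle (v :: L)) w =
      (toNCPoly (lyndonShuffle L)).sum fun ξ a => a * shuffle v.1 ξ w := by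
  rw [lyndonShuffle, List.map_cons, List.prod_cons, toNCPoly_word_mul, Finsupp.sum_apply]
  rfl

theorem lyndonShuffle_nonneg (L : List (LyndonWord m)) (w : Word m) :
    0 ≤ toNCPoly (lyndonShuffle L) w := by
  induction L generalizing w with
  | nil =>
    change 0 ≤ toNCPoly (1 : ShuffleAlgebra m) w
    rw [toNCPoly_one, Finsupp.single_apply]
    split_ifs <;> norm_num
  | cons v L ih =>
    rw [toNCPoly_lyndonShuffle_cons_apply]
    exact Finset.sum_nonneg fun ξ _ => mul_nonneg (ih ξ) (shuffle_nonneg _ _ _)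

theorem length_eq_of_lyndonShuffle_ne_zero {L : List (LyndonWord m)} {w : Word m}
    (h : toNCPoly (lyndonShuffle L) w ≠ 0) : w.length = (lyndonFlatten L).length := by
  induction L generalizing w with
  | nil =>
    change toNCPoly (1 : ShuffleAlgebra m) w ≠ 0 at h
    rw [toNCPoly_one, Finsupp.single_apply_ne_zero] at h
    rw [h.1]
    rfl
  | cons v L ih =>
    rw [toNCPoly_lyndonShuffle_cons_apply] at h
    obtain ⟨ξ, hξ, hne⟩ := Finset.exists_ne_zero_of_sum_ne_zero h
    rw [(isShuffle_of_shuffle_ne_zero (right_ne_zero_of_mul hne)).length_eq,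
      ih (left_ne_zero_of_mul hne), lyndonFlatten_cons, List.length_append]

theorem le_lyndonFlatten_of_lyndonShuffle_ne_zero {L : List (LyndonWord m)}
    (hL : L.Pairwise (· ≥ ·)) {w : Word m} (h : toNCPoly (lyndonShuffle L) w ≠ 0) :
    w ≤ lyndonFlatten L := by
  induction L generalizing w with
  | nil =>
    change toNCPoly (1 : ShuffleAlgebra m) w ≠ 0 at h
    rw [toNCPoly_one, Finsupp.single_apply_ne_zero] at h
    rw [h.1]
    exact le_rfl
  | cons v L ih =>
    rw [toNCPoly_lyndonShuffle_cons_apply] at h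
    obtain ⟨ξ, -, hne⟩ := Finset.exists_ne_zero_of_sum_ne_zero h
    rw [List.pairwise_cons] at hL
    have hξ := left_ne_zero_of_mul hne
    obtain ⟨w', hw', hle⟩ :=
      (isShuffle_of_shuffle_ne_zero (right_ne_zero_of_mul hne)).exists_ge_right (ih hL.2 hξ)
        (length_eq_of_lyndonShuffle_ne_zero hξ)
    rw [lyndonFlatten_cons]
    refine hle.trans (IsShuffle.le_append_flatten ?_ ?_ (List.pairwise_map.2 hL.2) ?_ hw')
    · intro l hl
      obtain ⟨x, -, rfl⟩ := List.mem_map.1 hl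
      exact x.2.1
    · intro l hl t ht hts
      obtain ⟨x, -, rfl⟩ := List.mem_map.1 hl
      exact x.2.le_of_suffix ht hts
    · intro t ht hts l hl
      obtain ⟨x, hx, rfl⟩ := List.mem_map.1 hl
      exact (show x.1 ≤ v.1 from hL.1 x hx).trans (v.2.le_of_suffix ht hts)

theorem lyndonShuffle_lyndonFlatten_pos (L : List (LyndonWord m)) :
    0 < toNCPoly (lyndonShuffle L) (lyndonFlatten L) := by
  induction L with
  | nil =>
    change 0 < toNCPoly (1 : ShuffleAlgebra m) []
    simp [toNCPoly_one]
  | cons v L ih =>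
    rw [toNCPoly_lyndonShuffle_cons_apply, lyndonFlatten_cons]
    exact Finset.sum_pos' (fun ξ _ => mul_nonneg (lyndonShuffle_nonneg L ξ) (shuffle_nonneg _ _ _))
      ⟨lyndonFlatten L, Finsupp.mem_support_iff.2 ih.ne', mul_pos ih (shuffle_append_pos _ _)⟩

/-- The algebra homomorphism from the polynomials in the Lyndon words to the shuffle algebra that
is the identity on Lyndon words. -/
noncomputable def lyndonAlgHom (m : ℕ) : MvPolynomial (LyndonWord m) ℝ →ₐ[ℝ] ShuffleAlgebra m :=
  MvPolynomial.aeval fun w => word w.1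

theorem lyndonAlgHom_monomial (l : LyndonMonomial m) :
    lyndonAlgHom m (MvPolynomial.monomial l 1) =
      lyndonShuffle ((Finsupp.toMultiset l).sort (· ≥ ·)) := by
  rw [lyndonAlgHom, MvPolynomial.aeval_monomial, map_one, one_mul, lyndonShuffle,
    ← Multiset.prod_coe, ← Multiset.map_coe, Multiset.sort_eq, Finsupp.toMultiset_map,
    Finsupp.prod_toMultiset, Finsupp.prod_mapDomain_index (by simp) (by simp [pow_add])]

theorem length_eq_of_lyndonAlgHom_monomial_ne_zero {l : LyndonMonomial m} {w : Word m}
    (h : toNCPoly (lyndonAlgHom m (MvPolynomial.monomial l 1)) w ≠ 0) :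
    w.length = lyndonDegree l := by
  rw [lyndonAlgHom_monomial] at h
  exact (length_eq_of_lyndonShuffle_ne_zero h).trans l.length_toWord

theorem le_toWord_of_lyndonAlgHom_monomial_ne_zero {l : LyndonMonomial m} {w : Word m}
    (h : toNCPoly (lyndonAlgHom m (MvPolynomial.monomial l 1)) w ≠ 0) : w ≤ l.toWord := by
  rw [lyndonAlgHom_monomial] at h
  exact le_lyndonFlatten_of_lyndonShuffle_ne_zero (Multiset.pairwise_sort ..) h

theorem lyndonAlgHom_monomial_toWord_pos (l : LyndonMonomial m) :
    0 < toNCPoly (lyndonAlgHom m (MvPolynomial.monomial l 1)) l.toWord := by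
  rw [lyndonAlgHom_monomial]
  exact lyndonShuffle_lyndonFlatten_pos _

theorem toNCPoly_lyndonAlgHom_apply (p : MvPolynomial (LyndonWord m) ℝ) (w : Word m) :
    toNCPoly (lyndonAlgHom m p) w = ∑ l ∈ p.support,
      p.coeff l * toNCPoly (lyndonAlgHom m (MvPolynomial.monomial l 1)) w := by
  conv_lhs => rw [p.as_sum]
  rw [map_sum, map_sum, Finsupp.finsetSum_apply]
  refine Finset.sum_congr rfl fun l _ => ?_
  have : MvPolynomial.monomial l (p.coeff l) = p.coeff l • MvPolynomial.monomial l (1 : ℝ) := by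
    rw [MvPolynomial.smul_monomial, smul_eq_mul, mul_one]
  rw [this, map_smul, map_smul, Finsupp.smul_apply, smul_eq_mul]

/-- Among the monomials of `p`, the one with the largest word is the only one contributing to the
coefficient of that word. -/
theorem lyndonAlgHom_injective (m : ℕ) : Function.Injective (lyndonAlgHom m) := by
  refine (injective_iff_map_eq_zero _).2 fun p hp => ?_
  by_contra hne
  obtain ⟨l, hl, hmax⟩ :=
    p.support.exists_max_image LyndonMonomial.toWord (MvPolynomial.support_nonempty.2 hne)
  have h := toNCPoly_lyndonAlgHom_apply p (LyndonMonomial.toWord l)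
  rw [hp, map_zero, Finsupp.zero_apply, Finset.sum_eq_single l] at h
  · exact mul_ne_zero (MvPolynomial.mem_support_iff.1 hl)
      (lyndonAlgHom_monomial_toWord_pos l).ne' h.symm
  · intro l' hl' hne'
    by_contra h0
    exact hne' (LyndonMonomial.toWord_injective ((hmax l' hl').antisymm
      (le_toWord_of_lyndonAlgHom_monomial_ne_zero (right_ne_zero_of_mul h0))))
  · exact fun h' => absurd hl h'

theorem toNCPoly_symm_eq_sum (p : NCPoly m) :
    toNCPoly.symm p = ∑ η ∈ p.support, p η • word η := by
  apply toNCPoly.injective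
  rw [LinearEquiv.apply_symm_apply, map_sum]
  conv_lhs => rw [← p.sum_single]
  refine Finset.sum_congr rfl fun η _ => ?_
  rw [map_smul, toNCPoly_word, Finsupp.smul_single, smul_eq_mul, mul_one]

theorem word_mem_range_lyndonAlgHom (η : Word m) : word η ∈ (lyndonAlgHom m).range := by
  by_contra hη
  -- Fixing the length makes a least counterexample exist; the lexicographic order on all words need
  -- not be well-founded. Homogeneity keeps the lower terms in the same length.
  have hfin : {ξ : Word m | ξ.length = η.length ∧ word ξ ∉ (lyndonAlgHom m).range}.Finite :=
    (List.finite_length_eq (Letter m) η.length).subset fun ξ h => h.1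
  obtain ⟨ξ, ⟨hlen, hξ⟩, hmin⟩ := Set.exists_min_image _ id hfin ⟨η, rfl, hη⟩
  obtain ⟨l, rfl⟩ := LyndonMonomial.toWord_surjective ξ
  set p := lyndonAlgHom m (MvPolynomial.monomial l 1) with hp
  have hc := lyndonAlgHom_monomial_toWord_pos l
  rw [← hp] at hc
  have hsum : p = toNCPoly p l.toWord • word l.toWord +
      ∑ w ∈ (toNCPoly p).support.erase l.toWord, toNCPoly p w • word w := by
    conv_lhs => rw [← toNCPoly.symm_apply_apply p, toNCPoly_symm_eq_sum]
    exact (Finset.add_sum_erase _ _ (Finsupp.mem_support_iff.2 hc.ne')).symm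
  have hrest : ∑ w ∈ (toNCPoly p).support.erase l.toWord, toNCPoly p w • word w ∈
      (lyndonAlgHom m).range := by
    refine Subalgebra.sum_mem _ fun w hw => Subalgebra.smul_mem _ ?_ _
    obtain ⟨hne, hw⟩ := Finset.mem_erase.1 hw
    have hw := Finsupp.mem_support_iff.1 hw
    by_contra hmem
    refine hne ((le_toWord_of_lyndonAlgHom_monomial_ne_zero hw).antisymm (hmin w ⟨?_, hmem⟩))
    rw [length_eq_of_lyndonAlgHom_monomial_ne_zero hw, ← l.length_toWord, hlen]
  have hmem : toNCPoly p l.toWord • word l.toWord ∈ (lyndonAlgHom m).range := by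
    rw [eq_sub_of_add_eq hsum.symm]
    exact Subalgebra.sub_mem _ ⟨_, rfl⟩ hrest
  have := Subalgebra.smul_mem _ hmem (toNCPoly p l.toWord)⁻¹
  rw [smul_smul, inv_mul_cancel₀ hc.ne', one_smul] at this
  exact hξ this

theorem lyndonAlgHom_surjective (m : ℕ) : Function.Surjective (lyndonAlgHom m) := by
  intro p
  rw [← toNCPoly.symm_apply_apply p, toNCPoly_symm_eq_sum]
  exact Subalgebra.sum_mem (lyndonAlgHom m).range fun η _ =>
    Subalgebra.smul_mem _ (word_mem_range_lyndonAlgHom η) _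

/-- The shuffle algebra is the polynomial algebra on the Lyndon words. -/
noncomputable def lyndonAlgEquiv (m : ℕ) :
    MvPolynomial (LyndonWord m) ℝ ≃ₐ[ℝ] ShuffleAlgebra m :=
  AlgEquiv.ofBijective (lyndonAlgHom m) ⟨lyndonAlgHom_injective m, lyndonAlgHom_surjective m⟩

end Triangularity

/-! ## Iterated integrals and shuffles -/

section IteratedIntegrals

/-- Integration by parts for primitives of integrable functions. -/
theorem intervalIntegral_mul_intervalIntegral {f g : ℝ → ℝ} {a b : ℝ}
    (hf : IntervalIntegrable f volume a b) (hg : IntervalIntegrable g volume a b) :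
    (∫ s in a..b, f s) * ∫ s in a..b, g s =
      (∫ s in a..b, f s * ∫ r in a..s, g r) + ∫ s in a..b, g s * ∫ r in a..s, f r := by
  -- The integrands are only integrable, so the primitives are absolutely continuous and recover
  -- them as derivatives almost everywhere.
  have hF := hf.absolutelyContinuousOnInterval_intervalIntegral (c := a) Set.left_mem_uIcc
  have hG := hg.absolutelyContinuousOnInterval_intervalIntegral (c := a) Set.left_mem_uIcc
  have h := hF.integral_deriv_mul_eq_sub hG
  simp only [intervalIntegral.integral_same, mul_zero, sub_zero] at h
  rw [← h, ← intervalIntegral.integral_add (hf.mul_continuousOn hG.continuousOn)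
    (hg.mul_continuousOn hF.continuousOn)]
  refine intervalIntegral.integral_congr_ae ?_
  filter_upwards [hf.ae_hasDerivAt_integral, hg.ae_hasDerivAt_integral] with x h1 h2 hx
  have hx' := Set.uIoc_subset_uIcc hx
  rw [(h1 hx' a Set.left_mem_uIcc).deriv, (h2 hx' a Set.left_mem_uIcc).deriv]
  ring

variable {m : ℕ} {u : ℝ → Fin m → ℝ} {t₀ t : ℝ}

/-- All components of the input, including `u₀ = 1`, are integrable between `t₀` and `t`. -/
def IsInput (u : ℝ → Fin m → ℝ) (t₀ t : ℝ) : Prop :=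
  ∀ i, IntervalIntegrable (fun s => (Fin.cons 1 (u s) : Letter m → ℝ) i) volume t₀ t

theorem isInput_of_integrableOn {t₁ : ℝ} (hu : ∀ i, IntegrableOn (fun s => u s i) (Set.Icc t₀ t₁))
    (ht : t ∈ Set.Icc t₀ t₁) : IsInput u t₀ t := by
  intro i
  induction i using Fin.cases with
  | zero => simp
  | succ i =>
    simp only [Fin.cons_succ]
    exact ((hu i).mono_set (Set.uIcc_of_le ht.1 ▸ Set.Icc_subset_Icc_right ht.2)).intervalIntegrable

theorem IsInput.mono (hu : IsInput u t₀ t) {s : ℝ} (hs : s ∈ Set.uIcc t₀ t) : IsInput u t₀ s :=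
  fun i => (hu i).mono_set (Set.uIcc_subset_uIcc_left hs)

theorem continuousOn_iteratedIntegral (hu : IsInput u t₀ t) (η : Word m) :
    ContinuousOn (iteratedIntegral u t₀ η) (Set.uIcc t₀ t) := by
  induction η with
  | nil => exact continuousOn_const
  | cons i η ih =>
    exact intervalIntegral.continuousOn_primitive_interval' ((hu i).mul_continuousOn ih)
      Set.left_mem_uIcc

theorem intervalIntegrable_mul_iteratedIntegral (hu : IsInput u t₀ t) (i : Letter m)
    (η : Word m) : IntervalIntegrable
      (fun s => (Fin.cons 1 (u s) : Letter m → ℝ) i * iteratedIntegral u t₀ η s) volume t₀ t :=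
  (hu i).mul_continuousOn (continuousOn_iteratedIntegral hu η)

/-- The linear extension `p ↦ E_p[u](t)` of the iterated integrals to polynomials. -/
noncomputable def polyIntegral (u : ℝ → Fin m → ℝ) (t₀ t : ℝ) : NCPoly m →ₗ[ℝ] ℝ :=
  Finsupp.linearCombination ℝ fun η => iteratedIntegral u t₀ η t

@[simp] theorem polyIntegral_single (η : Word m) (a : ℝ) :
    polyIntegral u t₀ t (Finsupp.single η a) = a * iteratedIntegral u t₀ η t := by
  simp [polyIntegral]

/-- Integrability is carried along because the additive step of the induction needs it. -/
theorem polyIntegral_consLin (hu : IsInput u t₀ t) (i : Letter m) (p : NCPoly m) :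
    IntervalIntegrable (fun s => (Fin.cons 1 (u s) : Letter m → ℝ) i * polyIntegral u t₀ s p)
        volume t₀ t ∧
      polyIntegral u t₀ t (consLin i p) =
        ∫ s in t₀..t, (Fin.cons 1 (u s) : Letter m → ℝ) i * polyIntegral u t₀ s p := by
  induction p using Finsupp.induction_linear with
  | zero => simp
  | add p q hp hq =>
    simp only [map_add, mul_add]
    exact ⟨hp.1.add hq.1, by rw [intervalIntegral.integral_add hp.1 hq.1, hp.2, hq.2]⟩
  | single η a =>
    have h := intervalIntegrable_mul_iteratedIntegral hu i η
    simp only [polyIntegral_single, consLin_single, mul_left_comm _ a]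
    exact ⟨h.const_mul a, by rw [intervalIntegral.integral_const_mul, iteratedIntegral]⟩

/-- Products of iterated integrals are given by the shuffle product. -/
theorem polyIntegral_shuffle (hu : IsInput u t₀ t) (η ξ : Word m) :
    polyIntegral u t₀ t (shuffle η ξ) =
      iteratedIntegral u t₀ η t * iteratedIntegral u t₀ ξ t := by
  induction η, ξ using shuffle.induct generalizing t with
  | case1 ξ => simp [shuffle_nil_left, iteratedIntegral]
  | case2 i η => simp [shuffle_nil_right, iteratedIntegral]
  | case3 i η j ξ ih1 ih2 =>
    have h1 := (polyIntegral_consLin hu i (shuffle η (j :: ξ))).2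
    have h2 := (polyIntegral_consLin hu j (shuffle (i :: η) ξ)).2
    rw [shuffle_cons_cons, map_add]
    change polyIntegral u t₀ t (consLin i _) + polyIntegral u t₀ t (consLin j _) = _
    rw [h1, h2, iteratedIntegral, iteratedIntegral, intervalIntegral_mul_intervalIntegral
      (intervalIntegrable_mul_iteratedIntegral hu i η)
      (intervalIntegrable_mul_iteratedIntegral hu j ξ)]
    congr 1
    · refine intervalIntegral.integral_congr fun s hs => ?_
      simp only [ih1 (hu.mono hs), iteratedIntegral, mul_assoc]
    · refine intervalIntegral.integral_congr fun s hs => ?_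
      simp only [ih2 (hu.mono hs), iteratedIntegral]
      ring

/-- The iterated integrals at a fixed time as a character of the shuffle algebra. -/
noncomputable def integralAlgHom (hu : IsInput u t₀ t) : ShuffleAlgebra m →ₐ[ℝ] ℝ :=
  ShuffleAlgebra.liftAlgHom (polyIntegral u t₀ t) (by simp [iteratedIntegral]) fun η ξ => by
    rw [polyIntegral_shuffle hu, polyIntegral_single, polyIntegral_single, one_mul, one_mul]

theorem integralAlgHom_lyndonAlgHom_monomial (hu : IsInput u t₀ t) (l : LyndonMonomial m) :
    integralAlgHom hu (lyndonAlgHom m (MvPolynomial.monomial l 1)) = lyndonIntegral u t₀ t l := by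
  have h : (integralAlgHom hu).comp (lyndonAlgHom m) =
      MvPolynomial.aeval fun w : LyndonWord m => iteratedIntegral u t₀ w.1 t := by
    ext w
    simp [lyndonAlgHom, integralAlgHom, ShuffleAlgebra.liftAlgHom_apply,
      ShuffleAlgebra.toNCPoly_word]
  rw [← AlgHom.comp_apply, h, MvPolynomial.aeval_monomial, map_one, one_mul, lyndonIntegral]

end IteratedIntegrals

/-! ## Inverses of transductions -/

namespace Transduction

variable {A B : Type} {τ : Transduction A B} {σ σ' : Transduction B A}

/-- This is `σ = σ(τσ') = (στ)σ' = σ'`. The sums are cut down to the support of row `b` of `σ` and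
the union of the corresponding rows of `τ`, so that they can be exchanged. -/
theorem IsInverse.unique (h : τ.IsInverse σ) (h' : τ.IsInverse σ') : σ = σ' := by
  classical
  funext b a
  have hS := h.2.1.1 b
  have hT : (⋃ a' ∈ hS.toFinset, {b' | τ a' b' ≠ 0}).Finite :=
    hS.toFinset.finite_toSet.biUnion fun a' _ => h.1.1 a'
  have e1 : ∀ a' ∈ hS.toFinset,
      ∑ b' ∈ hT.toFinset, τ a' b' * σ' b' a = if a' = a then 1 else 0 := by
    intro a' ha'
    rw [← h'.2.2.1 a' a]
    refine (finsum_eq_sum_of_support_subset _ fun b' hb' => ?_).symm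
    simp only [Set.Finite.coe_toFinset, Set.mem_iUnion]
    exact ⟨a', ha', left_ne_zero_of_mul hb'⟩
  have e2 : ∀ b', ∑ a' ∈ hS.toFinset, σ b a' * τ a' b' = if b = b' then 1 else 0 := by
    intro b'
    rw [← h.2.2.2 b b']
    refine (finsum_eq_sum_of_support_subset _ fun a' ha' => ?_).symm
    simpa using left_ne_zero_of_mul ha'
  have hbT : ∀ b', b' ∉ hT.toFinset → (if b = b' then (1 : ℝ) else 0) = 0 := by
    intro b' hb'
    rw [← e2 b']
    refine Finset.sum_eq_zero fun a' ha' => ?_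
    by_contra hne
    refine hb' ?_
    simp only [Set.Finite.mem_toFinset, Set.mem_iUnion]
    exact ⟨a', (Set.Finite.mem_toFinset _).1 ha', right_ne_zero_of_mul hne⟩
  calc σ b a = ∑ a' ∈ hS.toFinset, σ b a' * if a' = a then 1 else 0 := by
        simp only [mul_ite, mul_one, mul_zero, Finset.sum_ite_eq', Set.Finite.mem_toFinset,
          Set.mem_ofPred_eq]
        split_ifs with h0
        · rfl
        · exact not_not.1 h0
    _ = ∑ a' ∈ hS.toFinset, ∑ b' ∈ hT.toFinset, σ b a' * τ a' b' * σ' b' a := by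
        refine Finset.sum_congr rfl fun a' ha' => ?_
        rw [← e1 a' ha', Finset.mul_sum]
        simp only [mul_assoc]
    _ = ∑ b' ∈ hT.toFinset, (if b = b' then 1 else 0) * σ' b' a := by
        rw [Finset.sum_comm]
        refine Finset.sum_congr rfl fun b' _ => ?_
        rw [← e2 b', Finset.sum_mul]
    _ = σ' b a := by
        simp only [ite_mul, one_mul, zero_mul, Finset.sum_ite_eq]
        split_ifs with h0
        · rfl
        · exact absurd (hbT b h0) (by simp)

theorem IsInverse.inverse_eq (h : τ.IsInverse σ) : τ.inverse = σ := by
  have hex : ∃ σ, τ.IsInverse σ := ⟨σ, h⟩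
  rw [inverse, dif_pos hex]
  exact hex.choose_spec.unique h

theorem IsInverse.dagger_eq (h : τ.IsInverse σ) : τ.dagger = σ.adjoint := by
  rw [dagger, h.inverse_eq]

open Classical in
theorem IsInverse.adjoint (h : τ.IsInverse σ) : σ.adjoint.IsInverse τ.adjoint := by
  refine ⟨⟨h.2.1.2, h.2.1.1⟩, ⟨h.1.2, h.1.1⟩, fun a a' => ?_, fun b b' => ?_⟩
  · simp only [Transduction.adjoint, mul_comm (σ _ _), h.2.2.1]
    exact if_congr eq_comm rfl rfl
  · simp only [Transduction.adjoint, mul_comm (τ _ _), h.2.2.2]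
    exact if_congr eq_comm rfl rfl

theorem IsInverse.dagger_dagger (h : τ.IsInverse σ) : τ.dagger.dagger = τ := by
  rw [h.dagger_eq, h.adjoint.dagger_eq]
  rfl

end Transduction

/-! ## The Lyndon map -/

section LyndonMap

open ShuffleAlgebra

variable {m : ℕ}

/-- The isomorphism from `ℝ⟨X⟩` to the polynomials in the Lyndon words. -/
noncomputable def lyndonMap (m : ℕ) : NCPoly m ≃ₗ[ℝ] MvPolynomial (LyndonWord m) ℝ :=
  toNCPoly.symm.trans (lyndonAlgEquiv m).symm.toLinearEquiv

theorem lyndonMap_symm_apply (p : MvPolynomial (LyndonWord m) ℝ) :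
    (lyndonMap m).symm p = toNCPoly (lyndonAlgHom m p) := rfl

theorem lyndonMap_apply (p : NCPoly m) :
    lyndonMap m p = (lyndonAlgEquiv m).symm (toNCPoly.symm p) := rfl

theorem isLyndonMap_lyndonMap (m : ℕ) : IsLyndonMap (lyndonMap m).toLinearMap where
  map_empty := map_one (lyndonAlgEquiv m).symm
  map_shuffle η ξ := by
    simp only [LinearEquiv.coe_coe, lyndonMap_apply]
    rw [← map_mul, ← word_mul_word]
    rfl
  map_lyndon w := by
    rw [LinearEquiv.coe_coe, ← LinearEquiv.eq_symm_apply, lyndonMap_symm_apply, lyndonAlgHom,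
      MvPolynomial.aeval_X, toNCPoly_word]

/-- Composed with `lyndonAlgHom`, `f` is an algebra endomorphism fixing the variables, so it is a
left inverse of a bijection. -/
theorem IsLyndonMap.eq_lyndonMap {f : NCPoly m →ₗ[ℝ] MvPolynomial (LyndonWord m) ℝ}
    (hf : IsLyndonMap f) : f = (lyndonMap m).toLinearMap := by
  have h : (liftAlgHom f hf.map_empty hf.map_shuffle).comp (lyndonAlgHom m) =
      AlgHom.id ℝ _ := by
    ext1 w
    rw [AlgHom.comp_apply, lyndonAlgHom, MvPolynomial.aeval_X, liftAlgHom_apply, toNCPoly_word,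
      hf.map_lyndon, AlgHom.id_apply]
  refine LinearMap.ext fun p => ?_
  obtain ⟨q, rfl⟩ := (lyndonMap m).symm.surjective p
  rw [LinearEquiv.coe_coe, LinearEquiv.apply_symm_apply]
  exact DFunLike.congr_fun h q

theorem mem_lyndonMonomials {k : ℕ} {l : LyndonMonomial m} :
    l ∈ lyndonMonomials m k ↔ lyndonDegree l = k := by
  simp [lyndonMonomials]

/-- The inverse map is graded. Let `r` be the part of `ℒ(η)` in degrees other than `|η|`. Its
preimage has no words of length `|η|`, and at other lengths it agrees with `η`, hence vanishes; so
`r = 0`. -/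
theorem lyndonDegree_eq_of_toTransduction_ne_zero {η : Word m} {l : LyndonMonomial m}
    (h : toTransduction (lyndonMap m).toLinearMap η l ≠ 0) : lyndonDegree l = η.length := by
  classical
  by_contra hne
  set p := lyndonMap m (Finsupp.single η 1) with hp
  set S := p.support.filter fun l => lyndonDegree l ≠ η.length with hS
  set r : MvPolynomial (LyndonWord m) ℝ := ∑ l ∈ S, p.coeff l • MvPolynomial.monomial l 1 with hr
  have hr0 : r = 0 := by
    apply (lyndonMap m).symm.injective
    ext w
    rw [map_zero, Finsupp.zero_apply, hr, map_sum, Finsupp.finsetSum_apply]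
    simp only [map_smul, Finsupp.smul_apply, smul_eq_mul, lyndonMap_symm_apply]
    by_cases hw : w.length = η.length
    · refine Finset.sum_eq_zero fun l hl => ?_
      by_contra h0
      exact (Finset.mem_filter.1 hl).2
        ((length_eq_of_lyndonAlgHom_monomial_ne_zero (right_ne_zero_of_mul h0)).symm.trans hw)
    · rw [hS, Finset.sum_filter_of_ne, ← toNCPoly_lyndonAlgHom_apply, ← lyndonMap_symm_apply, hp,
        LinearEquiv.symm_apply_apply, Finsupp.single_eq_of_ne]
      · rintro rfl
        exact hw rfl
      · intro l _ h0 hl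
        exact hw ((length_eq_of_lyndonAlgHom_monomial_ne_zero (right_ne_zero_of_mul h0)).trans hl)
  have hc : MvPolynomial.coeff l r = MvPolynomial.coeff l p := by
    rw [hr, MvPolynomial.coeff_sum]
    simp only [MvPolynomial.coeff_smul, MvPolynomial.coeff_monomial, smul_eq_mul, mul_ite, mul_one,
      mul_zero, Finset.sum_ite_eq']
    exact if_pos (Finset.mem_filter.2 ⟨MvPolynomial.mem_support_iff.2 h, hne⟩)
  exact h (by rw [hr0] at hc; exact hc.symm)

theorem coeff_lyndonMap (q : NCPoly m) (l : LyndonMonomial m) :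
    MvPolynomial.coeff l (lyndonMap m q) =
      ∑ η ∈ q.support, q η * toTransduction (lyndonMap m).toLinearMap η l := by
  conv_lhs => rw [← q.sum_single]
  rw [Finsupp.sum, map_sum, MvPolynomial.coeff_sum]
  refine Finset.sum_congr rfl fun η _ => ?_
  rw [← smul_eq_mul, toTransduction, LinearEquiv.coe_coe, ← MvPolynomial.coeff_smul, ← map_smul,
    Finsupp.smul_single, smul_eq_mul, mul_one]

theorem isInverse_toTransduction_lyndonMap (m : ℕ) :
    (toTransduction (lyndonMap m).toLinearMap).IsInverse
      fun l η => (lyndonMap m).symm (MvPolynomial.monomial l 1) η := by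
  classical
  refine ⟨⟨fun η => ?_, fun l => ?_⟩, ⟨fun l => ?_, fun η => ?_⟩, fun η η' => ?_, fun l l' => ?_⟩
  · exact (lyndonMap m (Finsupp.single η 1)).support.finite_toSet.subset fun l hl =>
      MvPolynomial.mem_support_iff.2 hl
  · exact (List.finite_length_eq (Letter m) (lyndonDegree l)).subset fun η h =>
      (lyndonDegree_eq_of_toTransduction_ne_zero h).symm
  · exact ((lyndonMap m).symm (MvPolynomial.monomial l 1)).hasFiniteSupport
  · exact (finite_lyndonDegree_eq m η.length).subset fun l h =>
      (length_eq_of_lyndonAlgHom_monomial_ne_zero h).symm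
  · rw [finsum_eq_sum_of_support_subset (s := (lyndonMap m (Finsupp.single η 1)).support)]
    · have h := toNCPoly_lyndonAlgHom_apply (lyndonMap m (Finsupp.single η 1)) η'
      rw [← lyndonMap_symm_apply, LinearEquiv.symm_apply_apply, Finsupp.single_apply] at h
      convert h.symm <;> rfl
    · exact fun l hl => MvPolynomial.mem_support_iff.2 (left_ne_zero_of_mul hl)
  · rw [finsum_eq_sum_of_support_subset
      (s := ((lyndonMap m).symm (MvPolynomial.monomial l 1)).support), ← coeff_lyndonMap,
      LinearEquiv.apply_symm_apply, MvPolynomial.coeff_monomial]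
    · congr
    exact fun η hη => Finsupp.mem_support_iff.2 (left_ne_zero_of_mul hη)

variable {u : ℝ → Fin m → ℝ} {t₀ t : ℝ}

theorem polyIntegral_lyndonMap_symm_monomial (hu : IsInput u t₀ t) (l : LyndonMonomial m) :
    polyIntegral u t₀ t ((lyndonMap m).symm (MvPolynomial.monomial l 1)) =
      lyndonIntegral u t₀ t l :=
  integralAlgHom_lyndonAlgHom_monomial hu l

/-- The integral is evaluated on `η = ℒ⁻¹(ℒ(η))`. Summing over the whole degree rather than the
support makes the index set depend only on `|η|`, which later permits exchanging sums. -/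
theorem iteratedIntegral_eq_sum_lyndonIntegral (hu : IsInput u t₀ t) (η : Word m) :
    iteratedIntegral u t₀ η t = ∑ l ∈ lyndonMonomials m η.length,
      toTransduction (lyndonMap m).toLinearMap η l * lyndonIntegral u t₀ t l := by
  set p := lyndonMap m (Finsupp.single η 1) with hp
  have h1 : iteratedIntegral u t₀ η t = polyIntegral u t₀ t ((lyndonMap m).symm p) := by
    rw [hp, LinearEquiv.symm_apply_apply, polyIntegral_single, one_mul]
  rw [h1, p.as_sum, map_sum, map_sum]
  refine Finset.sum_subset_zero_on_sdiff (fun l hl => ?_) (fun l hl => ?_) fun l _ => ?_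
  · exact mem_lyndonMonomials.2
      (lyndonDegree_eq_of_toTransduction_ne_zero (MvPolynomial.mem_support_iff.1 hl))
  · have h0 : toTransduction (lyndonMap m).toLinearMap η l = 0 :=
      MvPolynomial.notMem_support_iff.1 (Finset.mem_sdiff.1 hl).2
    rw [h0, zero_mul]
  · have h2 : MvPolynomial.monomial l (p.coeff l) = p.coeff l • MvPolynomial.monomial l (1 : ℝ) := by
      rw [MvPolynomial.smul_monomial, smul_eq_mul, mul_one]
    rw [h2, map_smul, map_smul, polyIntegral_lyndonMap_symm_monomial hu, smul_eq_mul]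
    rfl

theorem apply_toTransduction_lyndonMap (c : NCSeries m) (l : LyndonMonomial m) :
    (toTransduction (lyndonMap m).toLinearMap).apply c l =
      ∑ η : Fin (lyndonDegree l) → Letter m, c (List.ofFn η) *
        toTransduction (lyndonMap m).toLinearMap (List.ofFn η) l := by
  classical
  rw [Transduction.apply, finsum_eq_sum_of_support_subset
    (s := Finset.univ.image fun η : Fin (lyndonDegree l) → Letter m => List.ofFn η),
    Finset.sum_image fun _ _ _ _ h => List.ofFn_injective h]
  intro η hη
  have h := lyndonDegree_eq_of_toTransduction_ne_zero (right_ne_zero_of_mul hη)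
  rw [Finset.coe_image, Finset.coe_univ, Set.image_univ, h]
  exact ⟨η.get, List.ofFn_get η⟩

theorem chenFliessPart_eq_lyndonPart (hu : IsInput u t₀ t) (c : NCSeries m) (k : ℕ) :
    chenFliessPart c u t₀ t k =
      lyndonPart ((toTransduction (lyndonMap m).toLinearMap).apply c) u t₀ t k := by
  have h1 : chenFliessPart c u t₀ t k = ∑ η : Fin k → Letter m, ∑ l ∈ lyndonMonomials m k,
      c (List.ofFn η) * toTransduction (lyndonMap m).toLinearMap (List.ofFn η) l *
        lyndonIntegral u t₀ t l := by
    refine Finset.sum_congr rfl fun η _ => ?_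
    rw [chenFliessTerm, iteratedIntegral_eq_sum_lyndonIntegral hu, List.length_ofFn,
      Finset.mul_sum]
    simp only [mul_assoc]
  rw [h1, Finset.sum_comm]
  refine Finset.sum_congr rfl fun l hl => ?_
  obtain rfl := mem_lyndonMonomials.1 hl
  rw [lyndonTerm, apply_toTransduction_lyndonMap, Finset.sum_mul]

theorem hasSum_chenFliessPart {c : NCSeries m} {y : ℝ} (h : HasSum (chenFliessTerm c u t₀ t) y) :
    HasSum (chenFliessPart c u t₀ t) y :=
  (List.equivSigmaTuple.symm.hasSum_iff.2 h).sigma fun _ => hasSum_fintype _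

theorem hasSum_lyndonPart {d : LyndonMonomial m → ℝ} {y : ℝ}
    (h : HasSum (lyndonTerm d u t₀ t) y) : HasSum (lyndonPart d u t₀ t) y := by
  refine ((Equiv.sigmaFiberEquiv (lyndonDegree (m := m))).hasSum_iff.2 h).sigma fun k => ?_
  let : Fintype {l : LyndonMonomial m // lyndonDegree l = k} :=
    Fintype.subtype (lyndonMonomials m k) fun _ => mem_lyndonMonomials
  rw [lyndonPart, Finset.sum_subtype (lyndonMonomials m k) fun _ => mem_lyndonMonomials]
  exact hasSum_fintype _

end LyndonMap

theorem mainTheorem1 (m : ℕ) :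
    ∃ 𝓛 : NCPoly m ≃ₗ[ℝ] MvPolynomial (LyndonWord m) ℝ,
      -- `𝓛` is the shuffle isomorphism that fixes the Lyndon words, and the only such map
      IsLyndonMap 𝓛.toLinearMap ∧
      (∀ 𝓛' : NCPoly m →ₗ[ℝ] MvPolynomial (LyndonWord m) ℝ,
        IsLyndonMap 𝓛' → 𝓛' = 𝓛.toLinearMap) ∧
      -- it is graded, so it acts on series by finite sums
      (∀ (η : Word m) (l : LyndonMonomial m),
        toTransduction 𝓛.toLinearMap η l ≠ 0 → lyndonDegree l = η.length) ∧
      -- the transduction `τ = 𝓛†` is invertible, with `τ† = 𝓛` and `τ* = 𝓛⁻¹`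
      (∃ σ, (toTransduction 𝓛.toLinearMap).dagger.IsInverse σ) ∧
      (toTransduction 𝓛.toLinearMap).dagger.dagger = toTransduction 𝓛.toLinearMap ∧
      (∀ (l : LyndonMonomial m) (η : Word m),
        (toTransduction 𝓛.toLinearMap).dagger.adjoint l η =
          𝓛.symm (MvPolynomial.monomial l 1) η) ∧
      ∀ (t₀ t₁ : ℝ) (u : ℝ → Fin m → ℝ),
        (∀ i, IntegrableOn (fun s => u s i) (Set.Icc t₀ t₁)) →
        ∀ t ∈ Set.Icc t₀ t₁,
          -- `E_{𝓛⁻¹(l)}[u] = E_{(l_{i₁})}[u] ⋯ E_{(l_{iₖ})}[u]`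
          (∀ l : LyndonMonomial m,
            ((𝓛.symm (MvPolynomial.monomial l 1)).sum fun η a => a * iteratedIntegral u t₀ η t) =
              lyndonIntegral u t₀ t l) ∧
          ∀ c : NCSeries m,
            -- with `𝓛(c) = τ†(c)`, the two series agree degree by degree
            (∀ k : ℕ, chenFliessPart c u t₀ t k =
              lyndonPart ((toTransduction 𝓛.toLinearMap).dagger.dagger.apply c) u t₀ t k) ∧
            -- summed by degree, one converges to `y` if and only if the other does
            (∀ y : ℝ,
              Tendsto (fun N => ∑ k ∈ Finset.range N, chenFliessPart c u t₀ t k) atTop (𝓝 y) ↔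
              Tendsto (fun N => ∑ k ∈ Finset.range N,
                lyndonPart ((toTransduction 𝓛.toLinearMap).dagger.dagger.apply c) u t₀ t k)
                atTop (𝓝 y)) ∧
            -- an absolutely convergent series is the sum by degree of the other one
            (∀ y : ℝ, HasSum (chenFliessTerm c u t₀ t) y →
              HasSum (lyndonPart ((toTransduction 𝓛.toLinearMap).dagger.dagger.apply c) u t₀ t)
                y) ∧
            (∀ y : ℝ,
              HasSum (lyndonTerm ((toTransduction 𝓛.toLinearMap).dagger.dagger.apply c) u t₀ t) y →
              HasSum (chenFliessPart c u t₀ t) y) ∧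
            -- and when both converge absolutely, their sums are equal
            (Summable (chenFliessTerm c u t₀ t) →
              Summable (lyndonTerm ((toTransduction 𝓛.toLinearMap).dagger.dagger.apply c) u t₀ t) →
              ∑' η, chenFliessTerm c u t₀ t η =
                ∑' l, lyndonTerm ((toTransduction 𝓛.toLinearMap).dagger.dagger.apply c)
                  u t₀ t l) := by
  have hinv := isInverse_toTransduction_lyndonMap m
  refine ⟨lyndonMap m, isLyndonMap_lyndonMap m, fun _ h => h.eq_lyndonMap,
    fun _ _ => lyndonDegree_eq_of_toTransduction_ne_zero, ?_, hinv.dagger_dagger, ?_, ?_⟩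
  · rw [hinv.dagger_eq]
    exact ⟨_, hinv.adjoint⟩
  · intro l η
    rw [hinv.dagger_eq]
    rfl
  intro t₀ t₁ u hu t ht
  have hin := isInput_of_integrableOn hu ht
  refine ⟨polyIntegral_lyndonMap_symm_monomial hin, fun c => ?_⟩
  rw [hinv.dagger_dagger]
  have hpart := funext (chenFliessPart_eq_lyndonPart hin c)
  refine ⟨congrFun hpart, fun y => by rw [hpart], fun y h => hpart ▸ hasSum_chenFliessPart h,
    fun y h => hpart ▸ hasSum_lyndonPart h, fun h h' => ?_⟩
  -- Both totals are sums of the same sequence of homogeneous parts.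
  have h1 := hasSum_chenFliessPart h.hasSum
  rw [hpart] at h1
  exact h1.unique (hasSum_lyndonPart h'.hasSum)
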